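/- For a finite graph $G$ and $\epsilon\in(0,1)$ let $cut^{\epsilon}(G)$ be the least $|S|$ over sets $S$ of vertices such that every connected component of $G-S$ has at most $\epsilon|G|$ vertices, where $|G|$ is the number of vertices of $G$. For a graph $X$ let $sep^{\epsilon}_X(n)=\sup\{cut^{\epsilon}(G): G\text{ a finite subgraph of }X,\ |G|\le n\}$. Write $f(n)\preceq g(n)$ for $f(n)=O(g(n))$ as $n\to\infty$ and $f\asymp g$ for $f\preceq g\preceq f$. Let $d\ge 2$, $b\ge 3$, $A\subseteq\{0,\dots,b-1\}$ and $0\le m\le d$. For $k\ge 0$ let $\Gamma_k(d,b,A,m)$ be the graph with vertex set $$V_k=\big\{(x_1,\dots,x_d)\in\mathbb Z^d\cap[0,b^k)^d:\ |\{i: x_{i,j}\in A\}|\le m\ \text{ for every } 0\le j<k\big\},$$ where $x_i=\sum_{j=0}^{k-1}x_{i,j}b^j$ with $x_{i,j}\in\{0,\dots,b-1\}$, two vertices being joined by an edge when their $\ell^1$-distance is $1$. Let $S(d,b,A,m)=\bigcup_{k\ge 0}\Gamma_k(d,b,A,m)$ (union of graphs). Put $$N=\sum_{i=0}^{m-1}\binom{d-1}{i}|A|^i(b-|A|)^{d-1-i}\quad(\text{with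 } 0^0=1),$$ assume that $N>0$, and let $E=\frac{\log N}{\log N+\log b}$. Then for every $\epsilon\in(0,1)$ $$sep^{\epsilon}_{S(d,b,A,m)}(n)\preceq n^{E}.$$ Moreover, if $m=1$, then $E=\frac{(d-1)\log(b-|A|)}{(d-1)\log(b-|A|)+\log b}$ and $sep^{\epsilon}_{S(d,b,A,1)}(n)\asymp n^{E}$. -/

import Mathlib

open Filter Asymptotics

noncomputable section

/-- Number of vertices of a largest connected component of a finite graph
(`0` for the graph without vertices). -/
def largestComponentCard {V : Type*} (G : SimpleGraph V) : ℕ :=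
  ⨆ c : G.ConnectedComponent, c.supp.ncard

/-- `cut^ε(G)` for a finite graph `G`: the least size of a set `S` of vertices such that every
connected component of `G - S` has at most `ε |G|` vertices. The set of admissible sizes contains
`|G|`, so the infimum is a minimum. -/
def cutSize {V : Type*} (ε : ℝ) (G : SimpleGraph V) : ℕ :=
  sInf {s : ℕ | ∃ S : Set V, S.ncard = s ∧
    (largestComponentCard (G.induce Sᶜ) : ℝ) ≤ ε * (Nat.card V : ℝ)}

/-- The `ε`-separation profile of `X`: the supremum of `cut^ε(G)` over the (not necessarily
induced) finite subgraphs `G` of `X` with at most `n` vertices. The set is bounded by `n`. -/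
def sepProfile {V : Type*} (ε : ℝ) (X : SimpleGraph V) (n : ℕ) : ℕ :=
  sSup {c : ℕ | ∃ G : X.Subgraph, G.verts.Finite ∧ G.verts.ncard ≤ n ∧ c = cutSize ε G.coe}

/-- The integer lattice graph on the orthant `ℤ^d ∩ [0, ∞)^d`: two points are adjacent when their
`ℓ¹`-distance is `1`. -/
def orthantGraph (d : ℕ) : SimpleGraph (Fin d → ℕ) where
  Adj x y := ∑ i, |(x i : ℤ) - (y i : ℤ)| = 1
  symm := ⟨fun x y h => by simpa only [abs_sub_comm] using h⟩
  loopless := ⟨fun x h => by simp at h⟩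

/-- The vertex set `V_k`: points of `[0, b^k)^d` such that, for each of the `k` digit positions
`j < k`, at most `m` coordinates have their `j`-th base-`b` digit in `A`. Leading zeros among the
first `k` digits count as digits. -/
def spongeVerts (d b : ℕ) (A : Finset ℕ) (m k : ℕ) : Set (Fin d → ℕ) :=
  {x | (∀ i, x i < b ^ k) ∧
    ∀ j < k, (Finset.univ.filter fun i => x i / b ^ j % b ∈ A).card ≤ m}

/-- The graph `Γ_k(d, b, A, m)`: the lattice graph induced on `V_k`. -/
def spongeLevel (d b : ℕ) (A : Finset ℕ) (m k : ℕ) : (orthantGraph d).Subgraph :=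
  (⊤ : (orthantGraph d).Subgraph).induce (spongeVerts d b A m k)

/-- The graph `S(d, b, A, m)`, the union over `k` of the graphs `Γ_k(d, b, A, m)`. -/
def sponge (d b : ℕ) (A : Finset ℕ) (m : ℕ) : (orthantGraph d).Subgraph :=
  ⨆ k : ℕ, spongeLevel d b A m k

/-- `N = ∑_{i=0}^{m-1} C(d-1, i) |A|^i (b - |A|)^{d-1-i}`. -/
def spongeN (d b : ℕ) (A : Finset ℕ) (m : ℕ) : ℕ :=
  ∑ i ∈ Finset.range m, (d - 1).choose i * A.card ^ i * (b - A.card) ^ (d - 1 - i)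

/-- `E = log N / (log N + log b)`. -/
def spongeE (d b : ℕ) (A : Finset ℕ) (m : ℕ) : ℝ :=
  Real.log (spongeN d b A m) / (Real.log (spongeN d b A m) + Real.log b)

end

/-!
Upper bound. Let `a` be a digit in `A` (any digit if `A` is empty). Inside a cube of side `b ^ j`
cut out by multiples of `b ^ j`, at most `N ^ j` points of the sponge have an `i`-th coordinate
ending in `j` digits `a`, since at each of these positions at most `m - 1` of the other coordinates
may have a digit in `A`. Cutting along all such hyperplanes, for `j = 0, …, k`, gives nested
partitions into boxes in which a box of scale `j + 1` falls apart into boxes of scale `j` when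
`O(N ^ j)` points are deleted. In a subgraph with at most `(b N) ^ k` vertices one first deletes the
points on parallel hyperplanes at distance `b ^ k`, which for a suitable shift number `O(N ^ k)`.
Each remaining piece meets at most `2 ^ d` boxes of scale `k`, and it suffices to keep isolating a
minimal box with more than a `2 ^ (-d) ε`-th of the vertices, which happens at most `2 ^ d / ε`
times.

Lower bound, for `m = 1`. Let `C` be the set of numbers below `b ^ k` without digits in `A`. The
points with all coordinates but one in `C` lie in `V_k` and form a grid of lines with about
`(b N) ^ k` points. Join a base point in `C ^ d` to each point of the grid by an axis-parallel path
along lines of the grid. If `T` is deleted, then for an average base point at most `d ^ 2 |T| b ^ k`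
of these paths meet `T`, and the targets of all others lie in one component of the rest. So `T` can
only be a separator if `|T|` is at least of the order of `N ^ k`.
-/

section Separators

variable {V W : Type*} {G : SimpleGraph V} {H : SimpleGraph W} {L ε : ℝ} {S : Set V}

/-- `S` separates `G` into pieces of size at most `L`: this is the condition imposed on `S` in the
definition of `cutSize`, with preconnected vertex sets of `G` avoiding `S` (possibly empty, not
necessarily maximal) in the role of the connected components of `G - S`. -/
def IsSeparator (G : SimpleGraph V) (L : ℝ) (S : Set V) : Prop :=
  ∀ F : Set V, Disjoint F S → (G.induce F).Preconnected → (F.ncard : ℝ) ≤ L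

lemma forall_mem_of_induce_preconnected {F : Set V} (hF : (G.induce F).Preconnected) {P : V → Prop}
    (hP : ∀ u ∈ F, ∀ v ∈ F, G.Adj u v → P u → P v) {w : V} (hw : w ∈ F) (hPw : P w) :
    ∀ v ∈ F, P v := by
  intro v hv
  obtain ⟨p⟩ := hF ⟨w, hw⟩ ⟨v, hv⟩
  suffices ∀ {x y : F}, (G.induce F).Walk x y → P x → P y from this p hPw
  intro x y p
  induction p with
  | nil => exact id
  | cons h _ ih => exact fun hx => ih (hP _ (Subtype.prop _) _ (Subtype.prop _) h hx)

lemma isSeparator_univ (hL : 0 ≤ L) : IsSeparator G L Set.univ := by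
  intro F hF _
  rw [Set.disjoint_univ.1 hF]
  simpa using hL

lemma IsSeparator.preimage_iso (h : IsSeparator G L S) (e : H ≃g G) :
    IsSeparator H L (e ⁻¹' S) := by
  intro F hFS hF
  have hdisj : Disjoint (e '' F) S := Set.disjoint_image_left.2 hFS
  have hconn : (G.induce (e '' F)).Preconnected :=
    hF.map (SimpleGraph.induceHom e.toHom (Set.mapsTo_image e F)) fun ⟨_, v, hv, hvy⟩ =>
      ⟨⟨v, hv⟩, Subtype.ext hvy⟩
  simpa only [Set.ncard_image_of_injective F e.injective] using h _ hdisj hconn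

lemma ncard_le_largestComponentCard [Finite V] {F : Set V} (hFS : Disjoint F S)
    (hF : (G.induce F).Preconnected) : F.ncard ≤ largestComponentCard (G.induce Sᶜ) := by
  obtain rfl | ⟨w, hw⟩ := F.eq_empty_or_nonempty
  · simp
  have hFS' : F ⊆ Sᶜ := Set.subset_compl_iff_disjoint_right.2 hFS
  let c := (G.induce Sᶜ).connectedComponentMk ⟨w, hFS' hw⟩
  have hsub : F ⊆ Subtype.val '' c.supp := fun v hv =>
    ⟨⟨v, hFS' hv⟩, SimpleGraph.ConnectedComponent.sound
      ((hF ⟨v, hv⟩ ⟨w, hw⟩).map (SimpleGraph.induceHomOfLE G hFS').toHom), rfl⟩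
  calc F.ncard ≤ (Subtype.val '' c.supp).ncard := Set.ncard_le_ncard hsub
    _ = c.supp.ncard := Set.ncard_image_of_injective _ Subtype.val_injective
    _ ≤ largestComponentCard (G.induce Sᶜ) :=
      le_ciSup (f := fun c : (G.induce Sᶜ).ConnectedComponent => c.supp.ncard)
        (Set.finite_range _).bddAbove c

lemma largestComponentCard_induce_compl_le_iff [Finite V] :
    (largestComponentCard (G.induce Sᶜ) : ℝ) ≤ L ↔ IsSeparator G L S := by
  refine ⟨fun h F hFS hF =>
    (Nat.cast_le.2 (ncard_le_largestComponentCard hFS hF)).trans h, fun h => ?_⟩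
  obtain hempty | hne := isEmpty_or_nonempty (G.induce Sᶜ).ConnectedComponent
  · have hL : 0 ≤ L := by simpa using h ∅ (Set.empty_disjoint S) fun v => v.2.elim
    simpa [largestComponentCard] using hL
  · obtain ⟨c, hc⟩ := exists_eq_ciSup_of_finite
      (f := fun c : (G.induce Sᶜ).ConnectedComponent => c.supp.ncard)
    have hdisj : Disjoint (Subtype.val '' c.supp) S :=
      Set.disjoint_left.2 fun _ ⟨v, _, hv⟩ => hv ▸ v.2
    have hconn : (G.induce (Subtype.val '' c.supp)).Preconnected :=
      c.connected_toSimpleGraph.preconnected.map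
        (SimpleGraph.induceHom (SimpleGraph.Embedding.induce Sᶜ).toHom
          (Set.mapsTo_image Subtype.val c.supp)) fun ⟨_, v, hv, hvy⟩ => ⟨⟨v, hv⟩, Subtype.ext hvy⟩
    rw [largestComponentCard, ← hc, ← Set.ncard_image_of_injective c.supp Subtype.val_injective]
    exact h _ hdisj hconn

lemma cutSize_le_ncard [Finite V] (h : IsSeparator G (ε * Nat.card V) S) :
    cutSize ε G ≤ S.ncard :=
  Nat.sInf_le ⟨S, rfl, largestComponentCard_induce_compl_le_iff.2 h⟩

lemma exists_isSeparator_ncard_eq_cutSize [Finite V] (G : SimpleGraph V) (hε : 0 ≤ ε) :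
    ∃ S, IsSeparator G (ε * Nat.card V) S ∧ S.ncard = cutSize ε G := by
  have hne : {s : ℕ | ∃ S : Set V, S.ncard = s ∧
      (largestComponentCard (G.induce Sᶜ) : ℝ) ≤ ε * (Nat.card V : ℝ)}.Nonempty :=
    ⟨_, Set.univ, rfl, largestComponentCard_induce_compl_le_iff.2
      (isSeparator_univ (by positivity))⟩
  obtain ⟨S, hcard, hS⟩ := Nat.sInf_mem hne
  exact ⟨S, largestComponentCard_induce_compl_le_iff.1 hS, hcard⟩

lemma cutSize_le_card [Finite V] (G : SimpleGraph V) (hε : 0 ≤ ε) : cutSize ε G ≤ Nat.card V := by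
  rw [← Set.ncard_univ]
  exact cutSize_le_ncard (isSeparator_univ (by positivity))

lemma cutSize_le_of_iso [Finite V] (e : H ≃g G) (hε : 0 ≤ ε) : cutSize ε H ≤ cutSize ε G := by
  have : Finite W := Finite.of_equiv V e.symm.toEquiv
  obtain ⟨S, hS, hcard⟩ := exists_isSeparator_ncard_eq_cutSize G hε
  rw [← hcard, ← Set.ncard_preimage_of_injective_subset_range (s := S) e.injective
    (by simp [e.surjective.range_eq])]
  refine cutSize_le_ncard ?_
  rw [Nat.card_congr e.toEquiv]
  exact hS.preimage_iso e

lemma cutSize_le_sepProfile {n : ℕ} [Finite V] (f : SimpleGraph.Copy G H) (hε : 0 ≤ ε)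
    (hn : Nat.card V ≤ n) : cutSize ε G ≤ sepProfile ε H n := by
  have hcard : f.toSubgraph.verts.ncard = Nat.card V :=
    (Nat.card_congr f.isoToSubgraph.toEquiv).symm
  have hfin : f.toSubgraph.verts.Finite := Finite.of_equiv V f.isoToSubgraph.toEquiv
  have : Finite f.toSubgraph.verts := hfin
  refine (cutSize_le_of_iso f.isoToSubgraph hε).trans
    (le_csSup ⟨n, ?_⟩ ⟨f.toSubgraph, hfin, hcard.trans_le hn, rfl⟩)
  rintro _ ⟨K, hK, hKn, rfl⟩
  have : Finite K.verts := hK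
  exact (cutSize_le_card K.coe hε).trans hKn

end Separators

section Hierarchy

variable {V α : Type*} {G : SimpleGraph V} [Finite V] {cell : ℕ → V → α} {k K t : ℕ}

lemma exists_separator_of_light_subcells {j : ℕ} {c : α} {W : Set V}
    (hcell : ∀ j u v, cell j u = cell j v → cell (j + 1) u = cell (j + 1) v)
    (hzero : ∀ c, {v | cell 0 v = c}.ncard ≤ K)
    (hwall : ∀ j < k, ∀ c, ∃ S : Set V, S.ncard ≤ K ∧
      ∀ u v, G.Adj u v → u ∉ S → v ∉ S → cell (j + 1) u = c → cell j u = cell j v)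
    (hj : j ≤ k) (hlight : ∀ i < j, ∀ c, {v ∈ W | cell i v = c}.ncard ≤ t) :
    ∃ S : Set V, S.ncard ≤ K ∧ ∀ F ⊆ W \ S, (G.induce F).Preconnected →
      (∃ w ∈ F, cell j w = c) → F.ncard ≤ t := by
  cases j with
  | zero => exact ⟨{v | cell 0 v = c}, hzero c, fun F hF _ ⟨w, hw, hwc⟩ => ((hF hw).2 hwc).elim⟩
  | succ j =>
    obtain ⟨S, hSK, hS⟩ := hwall j hj c
    refine ⟨S, hSK, fun F hFW hF ⟨w, hw, hwc⟩ => ?_⟩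
    have hsame : ∀ v ∈ F, cell j v = cell j w := by
      refine forall_mem_of_induce_preconnected hF (fun u hu v hv huv huw => ?_) hw rfl
      have huc : cell (j + 1) u = c := (hcell j u w huw).trans hwc
      exact (hS u v huv (hFW hu).2 (hFW hv).2 huc).symm.trans huw
    have hsub : F ⊆ {v ∈ W | cell j v = cell j w} := fun v hv => ⟨(hFW hv).1, hsame v hv⟩
    exact (Set.ncard_le_ncard hsub).trans (hlight j j.lt_succ_self _)

-- Split off a minimal cell with more than `t` points and recurse: a component that meets the
-- removed cell is confined to one of its light subcells, and each removal uses up `t + 1` points.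
theorem exists_separator_of_nested_cells
    (hcell : ∀ j u v, cell j u = cell j v → cell (j + 1) u = cell (j + 1) v)
    (hzero : ∀ c, {v | cell 0 v = c}.ncard ≤ K)
    (hwall : ∀ j < k, ∀ c, ∃ S : Set V, S.ncard ≤ K ∧
      ∀ u v, G.Adj u v → u ∉ S → v ∉ S → cell (j + 1) u = c → cell j u = cell j v)
    (W : Set V) :
    ∃ S : Set V, S.ncard * (t + 1) ≤ K * W.ncard ∧
      ∀ F ⊆ W \ S, (G.induce F).Preconnected → ∀ c, {v ∈ F | cell k v = c}.ncard ≤ t := by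
  classical
  induction W using WellFoundedLT.induction with
  | ind W ih =>
  by_cases hheavy : ∃ j c, t < {v ∈ W | cell j v = c}.ncard ∧ j ≤ k
  swap
  · push Not at hheavy
    refine ⟨∅, by simp, fun F hF _ c => not_lt.1 fun hc => ?_⟩
    have hsub : {v ∈ F | cell k v = c} ⊆ {v ∈ W | cell k v = c} := fun v hv => ⟨(hF hv.1).1, hv.2⟩
    exact (hheavy k c (hc.trans_le (Set.ncard_le_ncard hsub))).false
  obtain ⟨c, hc, hjk⟩ := Nat.find_spec hheavy
  set j := Nat.find hheavy
  have hlight : ∀ i < j, ∀ c, {v ∈ W | cell i v = c}.ncard ≤ t := fun i hi c =>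
    not_lt.1 fun h => Nat.find_min hheavy hi ⟨c, h, hi.le.trans hjk⟩
  obtain ⟨S, hSK, hS⟩ :=
    exists_separator_of_light_subcells (c := c) hcell hzero hwall hjk hlight
  set Q := {v ∈ W | cell j v = c}
  have hQW : Q ⊆ W := Set.sep_subset _ _
  have hQ : Q.Nonempty := Set.nonempty_of_ncard_ne_zero (by omega)
  obtain ⟨T, hTcard, hT⟩ := ih (W \ Q) (hQW.sdiff_ssubset_of_nonempty hQ)
  refine ⟨S ∪ T, ?_, fun F hF hconn c' => ?_⟩
  · calc (S ∪ T).ncard * (t + 1) ≤ S.ncard * (t + 1) + T.ncard * (t + 1) := by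
          rw [← add_mul]; gcongr; exact Set.ncard_union_le S T
      _ ≤ K * Q.ncard + K * (W \ Q).ncard := by gcongr; omega
      _ = K * W.ncard := by rw [← mul_add, add_comm, Set.ncard_sdiff_add_ncard_of_subset hQW]
  · by_cases hFQ : ∃ w ∈ F, cell j w = c
    · refine (Set.ncard_le_ncard (Set.sep_subset _ _)).trans (hS F (fun v hv => ?_) hconn hFQ)
      exact ⟨(hF hv).1, fun hvS => (hF hv).2 (Or.inl hvS)⟩
    · push Not at hFQ
      exact hT F (fun v hv => ⟨⟨(hF hv).1, fun hvQ => hFQ v hv hvQ.2⟩,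
        fun hvT => (hF hv).2 (Or.inr hvT)⟩) hconn c'

end Hierarchy

section DigitVectors

open Finset

variable {ι α : Type*} [Fintype ι] [DecidableEq ι] [DecidableEq α] {A B : Finset α}

lemma card_filter_filter_mem_eq (hAB : A ⊆ B) (I : Finset ι) :
    #{y ∈ Fintype.piFinset fun _ : ι => B | ({i | y i ∈ A} : Finset ι) = I} =
      #A ^ #I * (#B - #A) ^ (Fintype.card ι - #I) := by
  have heq : ({y ∈ Fintype.piFinset fun _ : ι => B | ({i | y i ∈ A} : Finset ι) = I}) =
      Fintype.piFinset fun i => if i ∈ I then A else B \ A := by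
    ext y
    simp only [mem_filter, Fintype.mem_piFinset, Finset.ext_iff, mem_univ, true_and,
      ← forall_and]
    refine forall_congr' fun i => ?_
    split_ifs with hi
    · simpa [hi] using @hAB (y i)
    · simp [hi]
  rw [heq, Fintype.card_piFinset]
  simp only [apply_ite card, prod_ite, prod_const, filter_univ_mem, filter_not,
    ← compl_eq_univ_sdiff, card_compl, card_sdiff_of_subset hAB]

lemma card_filter_card_filter_mem_lt (hAB : A ⊆ B) (m : ℕ) :
    #{y ∈ Fintype.piFinset fun _ : ι => B | #{i | y i ∈ A} < m} =
      ∑ k ∈ range m, (Fintype.card ι).choose k * #A ^ k * (#B - #A) ^ (Fintype.card ι - k) := by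
  rw [card_eq_sum_card_fiberwise (f := fun y : ι → α => #{i | y i ∈ A}) (t := range m)
    fun y hy => mem_coe.2 (mem_range.2 (mem_filter.1 hy).2)]
  refine sum_congr rfl fun k hk => ?_
  rw [card_eq_sum_card_fiberwise (f := fun y : ι → α => ({i | y i ∈ A} : Finset ι))
    (t := powersetCard k univ)
    fun y hy => mem_coe.2 (mem_powersetCard.2 ⟨subset_univ _, (mem_filter.1 hy).2⟩)]
  rw [sum_congr rfl (g := fun _ => #A ^ k * (#B - #A) ^ (Fintype.card ι - k)), sum_const,
    card_powersetCard, card_univ, smul_eq_mul, mul_assoc]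
  intro I hI
  obtain rfl := (mem_powersetCard.1 hI).2
  rw [← card_filter_filter_mem_eq hAB, filter_filter, filter_filter]
  congr 1
  refine filter_congr fun y _ => ⟨fun h => h.2.2, fun h => ?_⟩
  subst h
  exact ⟨mem_range.1 hk, rfl, rfl⟩

end DigitVectors

section Digits

variable {a b c j x y : ℕ}

/-- The number with `j` digits in base `b`, all of them equal to `c`. -/
def repdigit (c b j : ℕ) : ℕ := c * ∑ i ∈ Finset.range j, b ^ i

lemma repdigit_succ (c b j : ℕ) : repdigit c b (j + 1) = b * repdigit c b j + c := by
  rw [repdigit, repdigit, geom_sum_succ]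
  ring

lemma repdigit_succ' (c b j : ℕ) : repdigit c b (j + 1) = b ^ j * c + repdigit c b j := by
  rw [repdigit, repdigit, geom_sum_succ']
  ring

lemma add_repdigit_succ_div (hb : 0 < b) (x c j : ℕ) :
    (x + repdigit c b (j + 1)) / b ^ (j + 1) = ((x + repdigit c b j) / b ^ j + c) / b := by
  rw [repdigit_succ', pow_succ, ← Nat.div_div_eq_div_mul, add_left_comm,
    Nat.mul_add_div (pow_pos hb j), add_comm c]

lemma digit_eq_of_dvd_add_repdigit_add_one (hac : a + c + 1 = b) :
    ∀ {j x : ℕ}, b ^ j ∣ x + repdigit c b j + 1 → ∀ t < j, x / b ^ t % b = a := by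
  intro j
  induction j with
  | zero => exact fun _ t ht => absurd ht t.not_lt_zero
  | succ j ih =>
    intro x hx t ht
    rw [repdigit_succ] at hx
    have hlast : x % b = a := by
      have hmod : (x % b + c + 1) % b = 0 := by
        have h := Nat.mod_eq_zero_of_dvd ((dvd_pow_self b j.succ_ne_zero).trans hx)
        rwa [show x + (b * repdigit c b j + c) + 1 = x + (c + 1) + b * repdigit c b j by ring,
          Nat.add_mul_mod_self_left, ← Nat.mod_add_mod, ← add_assoc] at h
      have hlt : x % b < b := Nat.mod_lt _ (by omega)
      obtain ⟨q, hq⟩ := Nat.dvd_of_mod_eq_zero hmod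
      have hq0 : 0 < q := Nat.pos_of_mul_pos_left (by omega : 0 < b * q)
      have hq2 : q < 2 := Nat.lt_of_mul_lt_mul_left (a := b) (by omega)
      obtain rfl : q = 1 := by omega
      omega
    cases t with
    | zero => simpa using hlast
    | succ t =>
      have hdvd : b ^ j ∣ x / b + repdigit c b j + 1 := by
        refine Nat.dvd_of_mul_dvd_mul_left (by omega : 0 < b) ?_
        rw [← pow_succ']
        convert hx using 1
        nth_rw 2 [← Nat.div_add_mod x b]
        rw [hlast]; linarith
      rw [pow_succ', ← Nat.div_div_eq_div_mul]
      exact ih hdvd t (by omega)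

lemma mod_pow_eq_of_digits_eq (h : ∀ t < j, x / b ^ t % b = y / b ^ t % b) :
    x % b ^ j = y % b ^ j := by
  induction j with
  | zero => simp [Nat.mod_one]
  | succ j ih =>
    rw [Nat.mod_pow_succ, Nat.mod_pow_succ, ih fun t ht => h t (by omega), h j j.lt_succ_self]

lemma eq_of_mod_eq_of_add_div_eq {s : ℕ} (hmod : x % b = y % b)
    (hdiv : (x + s) / b = (y + s) / b) : x = y := by
  have h : (x + s) % b = (y + s) % b := Nat.ModEq.add_right s hmod
  have hx := Nat.div_add_mod (x + s) b
  rw [hdiv, h, Nat.div_add_mod] at hx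
  omega

end Digits

section SlabCount

open Finset

variable {d b m a : ℕ} {A : Finset ℕ}

/-- The digit vectors that may occur at one digit position of a point of `S(d, b, A, m)` whose
`i₀`-th coordinate has digit `a` there. -/
def digitSlice (d b : ℕ) (A : Finset ℕ) (m a : ℕ) (i₀ : Fin d) : Finset (Fin d → ℕ) :=
  {y ∈ Fintype.piFinset fun _ => range b | y i₀ = a ∧ #{i | y i ∈ A} ≤ m}

lemma pos_of_spongeN_pos (hN : 0 < spongeN d b A m) : 0 < m :=
  Nat.pos_of_ne_zero fun h => by simp [spongeN, h] at hN

lemma card_digitSlice_le (hA : A ⊆ range b) (ha : a ∈ A ∨ A = ∅) (hm : 0 < m) (i₀ : Fin d) :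
    #(digitSlice d b A m a i₀) ≤ spongeN d b A m := by
  have hcard : Fintype.card {i // i ≠ i₀} = d - 1 := by simp [Fintype.card_subtype_compl]
  have hsum := card_filter_card_filter_mem_lt (ι := {i // i ≠ i₀}) hA m
  rw [hcard, card_range] at hsum
  rw [spongeN, ← hsum]
  refine card_le_card_of_injOn (fun y i => y i.1) (fun y hy => ?_) fun y hy z hz hyz => ?_
  · simp only [digitSlice, coe_filter, Fintype.mem_piFinset, Set.mem_ofPred_eq] at hy ⊢
    refine ⟨fun i => hy.1 i, ?_⟩
    obtain ha | rfl := ha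
    · refine lt_of_lt_of_le ?_ hy.2.2
      rw [← card_map (Function.Embedding.subtype _)]
      refine card_lt_card ((ssubset_iff_of_subset fun i hi => ?_).2 ⟨i₀, ?_, ?_⟩)
      · obtain ⟨i, hyi, rfl⟩ := mem_map.1 hi
        exact mem_filter.2 ⟨mem_univ _, (mem_filter.1 hyi).2⟩
      · simp [hy.2.1, ha]
      · simp
    · simpa using hm
  · have hi₀ : y i₀ = z i₀ := (mem_filter.1 hy).2.1.trans (mem_filter.1 hz).2.1.symm
    funext i
    obtain rfl | hi := eq_or_ne i i₀
    exacts [hi₀, congrFun hyz ⟨i, hi⟩]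

lemma exists_card_digitSlice_le (hb : 0 < b) (hA : A ⊆ range b) (hm : 0 < m) :
    ∃ a < b, ∀ i₀ : Fin d, #(digitSlice d b A m a i₀) ≤ spongeN d b A m := by
  obtain rfl | ⟨a, ha⟩ := A.eq_empty_or_nonempty
  · exact ⟨0, hb, card_digitSlice_le hA (Or.inr rfl) hm⟩
  · exact ⟨a, mem_range.1 (hA ha), card_digitSlice_le hA (Or.inl ha) hm⟩

lemma card_le_pow_of_add_div_eq (hb : 0 < b) {N : ℕ} (hN : 0 < N) {i₀ : Fin d}
    (hslice : #(digitSlice d b A m a i₀) ≤ N) {j K s : ℕ} {q : Fin d → ℕ}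
    {X : Finset (Fin d → ℕ)} (hX : ∀ x ∈ X, x ∈ spongeVerts d b A m K)
    (hbox : ∀ x ∈ X, ∀ i, (x i + s) / b ^ j = q i)
    (hdigit : ∀ x ∈ X, ∀ t < j, x i₀ / b ^ t % b = a) : #X ≤ N ^ j := by
  let digits (x : Fin d → ℕ) (t : Fin (min j K)) (i : Fin d) : ℕ := x i / b ^ t.1 % b
  have hmaps : ∀ x ∈ X, digits x ∈ Fintype.piFinset fun _ => digitSlice d b A m a i₀ :=
    fun x hx => Fintype.mem_piFinset.2 fun t => mem_filter.2
      ⟨Fintype.mem_piFinset.2 fun i => mem_range.2 (Nat.mod_lt _ hb),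
        hdigit x hx t (t.2.trans_le (min_le_left _ _)),
        (hX x hx).2 t (t.2.trans_le (min_le_right _ _))⟩
  have hinj : Set.InjOn digits X := by
    intro x hx y hy hxy
    funext i
    have hmod : x i % b ^ min j K = y i % b ^ min j K :=
      mod_pow_eq_of_digits_eq fun t ht => congrFun (congrFun hxy ⟨t, ht⟩) i
    obtain hjK | hKj := le_total j K
    · rw [min_eq_left hjK] at hmod
      exact eq_of_mod_eq_of_add_div_eq hmod ((hbox x hx i).trans (hbox y hy i).symm)
    · rwa [min_eq_right hKj, Nat.mod_eq_of_lt ((hX x hx).1 i),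
        Nat.mod_eq_of_lt ((hX y hy).1 i)] at hmod
  calc #X ≤ #(Fintype.piFinset fun _ : Fin (min j K) => digitSlice d b A m a i₀) :=
        card_le_card_of_injOn digits hmaps hinj
    _ = #(digitSlice d b A m a i₀) ^ min j K := by simp
    _ ≤ N ^ min j K := by gcongr
    _ ≤ N ^ j := Nat.pow_le_pow_right hN (min_le_left _ _)

end SlabCount

section Boxes

open Finset

lemma orthantGraph_adj_iff_covBy {d : ℕ} {x y : Fin d → ℕ} :
    (orthantGraph d).Adj x y ↔ x ⋖ y ∨ y ⋖ x := by
  have hnat : (orthantGraph d).Adj x y ↔ ∑ i, ((x i : ℤ) - y i).natAbs = 1 := by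
    rw [orthantGraph, ← Nat.cast_inj (R := ℤ)]
    push_cast
    rfl
  have hiff : (orthantGraph d).Adj x y ↔ ∃ i, (x i ⋖ y i ∨ y i ⋖ x i) ∧ ∀ j ≠ i, x j = y j := by
    rw [hnat]
    refine ⟨fun h => ?_, fun ⟨i, hi, hne⟩ => ?_⟩
    · obtain ⟨i, -, hi⟩ := exists_ne_zero_of_sum_ne_zero (h.trans_ne one_ne_zero)
      rw [← add_sum_erase _ _ (mem_univ i)] at h
      have hrest := sum_eq_zero_iff.1
        (by omega : ∑ j ∈ univ.erase i, ((x j : ℤ) - y j).natAbs = 0)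
      refine ⟨i, by simp only [Nat.covBy_iff_add_one_eq]; omega, fun j hj => ?_⟩
      have := hrest j (mem_erase.2 ⟨hj, mem_univ j⟩)
      omega
    · rw [sum_eq_single i (fun j _ hj => by simp [hne j hj]) (by simp)]
      simp only [Nat.covBy_iff_add_one_eq] at hi
      omega
  simp only [hiff, Pi.covBy_iff, or_and_right, exists_or, eq_comm]

variable {ι : Type*} {B : ℕ} {s x y : ι → ℕ}

lemma le_add_one_of_covBy (hxy : x ⋖ y) : y ≤ x + 1 := by
  obtain ⟨i, hi, hne⟩ := Pi.covBy_iff.1 hxy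
  intro j
  obtain rfl | hj := eq_or_ne j i
  · exact (Nat.covBy_iff_add_one_eq.1 hi).ge
  · exact (hne j hj).ge.trans (Nat.le_succ _)

/-- The index of the box containing `x`, when the orthant is cut into boxes of side `B` whose last
points in direction `i` are the numbers congruent to `- s i - 1` modulo `B`. -/
def boxIndex (B : ℕ) (s x : ι → ℕ) (i : ι) : ℕ := (x i + s i) / B

lemma boxIndex_eq_of_covBy (hxy : x ⋖ y) (hx : ∀ i, ¬ B ∣ x i + s i + 1) :
    boxIndex B s x = boxIndex B s y := by
  obtain ⟨i, hi, hne⟩ := Pi.covBy_iff.1 hxy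
  funext j
  obtain rfl | hj := eq_or_ne j i
  · rw [boxIndex, boxIndex, ← Nat.covBy_iff_add_one_eq.1 hi, add_right_comm,
      Nat.succ_div_of_not_dvd (hx j)]
  · rw [boxIndex, boxIndex, hne j hj]

lemma card_image_boxIndex_le [Fintype ι] (hB : 0 < B) (s : ι → ℕ) {c : ℕ}
    {lo : ι → ℕ} {X : Finset (ι → ℕ)} (hX : ∀ x ∈ X, ∀ i, lo i ≤ x i ∧ x i ≤ lo i + c * B) :
    #(X.image (boxIndex B s)) ≤ (c + 1) ^ Fintype.card ι := by
  classical
  have hsub : X.image (boxIndex B s) ⊆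
      Fintype.piFinset fun i => Ico ((lo i + s i) / B) ((lo i + s i) / B + (c + 1)) := by
    intro y hy
    obtain ⟨x, hx, rfl⟩ := mem_image.1 hy
    refine Fintype.mem_piFinset.2 fun i => mem_Ico.2 ⟨?_, Nat.lt_succ_of_le ?_⟩
    · exact Nat.div_le_div_right (Nat.add_le_add_right (hX x hx i).1 _)
    · change (x i + s i) / B ≤ (lo i + s i) / B + c
      rw [← Nat.add_mul_div_right _ _ hB]
      exact Nat.div_le_div_right (by linarith [(hX x hx i).2])
  simpa [Fintype.card_piFinset] using card_le_card hsub

lemma exists_shift_card_dvd_le {V : Type*} [Fintype V] {M : ℕ} (hB : 0 < B)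
    (hV : Fintype.card V ≤ B * M) (f : V → ℕ) : ∃ s, #{v | B ∣ f v + s + 1} ≤ M := by
  obtain ⟨r, hr, hcard⟩ := exists_card_fiber_le_of_card_le_mul (s := (univ : Finset V))
    (t := range B) (f := fun v => f v % B) (nonempty_range_iff.2 hB.ne') (by simpa using hV)
  obtain ⟨s, rfl⟩ := Nat.exists_eq_add_of_lt (mem_range.1 hr)
  refine ⟨s, (card_le_card fun v hv => ?_).trans hcard⟩
  simp only [mem_filter_univ] at hv ⊢
  have hmod : f v + (s + 1) ≡ r + (s + 1) [MOD r + s + 1] :=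
    ((Nat.modEq_zero_iff_dvd).2 hv).trans (Nat.modEq_zero_iff_dvd.2 ⟨1, by ring⟩).symm
  have hr : f v % (r + s + 1) = r % (r + s + 1) := Nat.ModEq.add_right_cancel' _ hmod
  rw [hr, Nat.mod_eq_of_lt (by omega)]

end Boxes

section UpperBound

open Finset

variable {d b m a c N j k K : ℕ} {A : Finset ℕ} {V : Type*} {G : SimpleGraph V} {lev : V → ℕ}
  {pos : V → Fin d → ℕ}

lemma card_le_of_forall_exists_dvd (hac : a + c + 1 = b) (hN : 0 < N)
    (hslice : ∀ i, #(digitSlice d b A m a i) ≤ N) {lo : Fin d → ℕ} {X : Finset (Fin d → ℕ)}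
    (hX : ∀ x ∈ X, x ∈ spongeVerts d b A m K)
    (hlo : ∀ x ∈ X, ∀ i, lo i ≤ x i ∧ x i ≤ lo i + b * b ^ j)
    (hwall : ∀ x ∈ X, ∃ i, b ^ j ∣ x i + repdigit c b j + 1) :
    #X ≤ d * (b + 1) ^ d * N ^ j := by
  have hb : 0 < b := by omega
  let Y (i : Fin d) : Finset (Fin d → ℕ) := {x ∈ X | b ^ j ∣ x i + repdigit c b j + 1}
  have hcover : X ⊆ univ.biUnion Y := fun x hx =>
    mem_biUnion.2 ((hwall x hx).imp fun i hi => ⟨mem_univ i, mem_filter.2 ⟨hx, hi⟩⟩)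
  have hY : ∀ i ∈ univ, #(Y i) ≤ (b + 1) ^ d * N ^ j := by
    intro i _
    have hYX : ∀ x ∈ Y i, x ∈ X := fun x hx => (mem_filter.1 hx).1
    calc #(Y i) ≤ N ^ j * #((Y i).image (boxIndex (b ^ j) fun _ => repdigit c b j)) := by
          refine card_le_mul_card_image _ _ fun q _ =>
            card_le_pow_of_add_div_eq (K := K) (s := repdigit c b j) (q := q) hb hN (hslice i)
              (fun x hx => ?_) (fun x hx l => ?_) fun x hx => ?_
          · exact hX x (hYX x (mem_filter.1 hx).1)
          · exact congrFun (mem_filter.1 hx).2 l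
          · exact digit_eq_of_dvd_add_repdigit_add_one hac
              (mem_filter.1 (mem_filter.1 hx).1).2
      _ ≤ N ^ j * (b + 1) ^ d := by
          gcongr
          simpa using card_image_boxIndex_le (pow_pos hb j) (fun _ => repdigit c b j)
            fun x hx => hlo x (hYX x hx)
      _ = (b + 1) ^ d * N ^ j := mul_comm _ _
  calc #X ≤ #(univ.biUnion Y) := card_le_card hcover
    _ ≤ #(univ : Finset (Fin d)) * ((b + 1) ^ d * N ^ j) := card_biUnion_le_card_mul _ _ _ hY
    _ = d * (b + 1) ^ d * N ^ j := by rw [card_univ, Fintype.card_fin, mul_assoc]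

/-- The level of a vertex together with the box of scale `j` containing it. Boxes of scale `j` end
at the numbers whose last `j` digits in base `b` are all equal to `b - 1 - c`. -/
def levelBox (b c : ℕ) (lev : V → ℕ) (pos : V → Fin d → ℕ) (j : ℕ) (v : V) : ℕ × (Fin d → ℕ) :=
  (lev v, boxIndex (b ^ j) (fun _ => repdigit c b j) (pos v))

lemma levelBox_succ_eq_of_levelBox_eq (hb : 0 < b) {u v : V}
    (h : levelBox b c lev pos j u = levelBox b c lev pos j v) :
    levelBox b c lev pos (j + 1) u = levelBox b c lev pos (j + 1) v := by
  obtain ⟨hlev, hbox⟩ := Prod.ext_iff.1 h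
  refine Prod.ext hlev (funext fun i => ?_)
  have hi : (pos u i + repdigit c b j) / b ^ j = (pos v i + repdigit c b j) / b ^ j :=
    congrFun hbox i
  simp only [levelBox, boxIndex, add_repdigit_succ_div hb, hi]

lemma levelBox_zero_injective (hpos : Function.Injective pos) :
    Function.Injective (levelBox b c lev pos 0) := fun u v h =>
  hpos (funext fun i => by simpa [levelBox, boxIndex] using congrFun (Prod.ext_iff.1 h).2 i)

lemma exists_wall [Finite V] (hac : a + c + 1 = b) (hN : 0 < N)
    (hslice : ∀ i, #(digitSlice d b A m a i) ≤ N) (hpos : Function.Injective pos)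
    (hmem : ∀ v, pos v ∈ spongeVerts d b A m (lev v))
    (hadj : ∀ u v, G.Adj u v → (orthantGraph d).Adj (pos u) (pos v) ∧ lev u = lev v)
    (j : ℕ) (q : ℕ × (Fin d → ℕ)) :
    ∃ S : Set V, S.ncard ≤ d * (b + 1) ^ d * N ^ j ∧ ∀ u v, G.Adj u v → u ∉ S → v ∉ S →
      levelBox b c lev pos (j + 1) u = q → levelBox b c lev pos j u = levelBox b c lev pos j v := by
  classical
  have := Fintype.ofFinite V
  let S : Finset V := {v | (∃ i, b ^ j ∣ pos v i + repdigit c b j + 1) ∧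
    ∃ u, levelBox b c lev pos (j + 1) u = q ∧ lev v = lev u ∧ pos v ≤ pos u ∧ pos u ≤ pos v + 1}
  refine ⟨S, ?_, fun u v huv hu hv huq => ?_⟩
  · rw [Set.ncard_coe_finset, ← card_image_of_injective S hpos]
    refine card_le_of_forall_exists_dvd (K := q.1)
      (lo := fun i => q.2 i * b ^ (j + 1) - (repdigit c b (j + 1) + 1)) hac hN hslice ?_ ?_ ?_ <;>
      refine forall_mem_image.2 fun v hv => ?_ <;>
      obtain ⟨hwall, u, rfl, hlev, hle, hle'⟩ := (mem_filter_univ v).1 hv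
    · rw [levelBox, ← hlev]
      exact hmem v
    · intro i
      have hB : 0 < b ^ (j + 1) := pow_pos (by omega) _
      have hlow := Nat.div_mul_le_self (pos u i + repdigit c b (j + 1)) (b ^ (j + 1))
      have hupp := Nat.lt_div_mul_add (a := pos u i + repdigit c b (j + 1)) hB
      have hvu : pos v i ≤ pos u i := hle i
      have huv : pos u i ≤ pos v i + 1 := hle' i
      rw [← pow_succ']
      simp only [levelBox, boxIndex]
      omega
    · exact hwall
  · obtain ⟨hcov, hlev⟩ := hadj u v huv
    refine Prod.ext hlev ?_
    obtain hcov | hcov := orthantGraph_adj_iff_covBy.1 hcov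
    · refine boxIndex_eq_of_covBy hcov fun i hi => hu ?_
      exact mem_coe.2 ((mem_filter_univ u).2
        ⟨⟨i, hi⟩, u, huq, rfl, le_rfl, le_add_of_nonneg_right zero_le_one⟩)
    · refine (boxIndex_eq_of_covBy hcov fun i hi => hv ?_).symm
      exact mem_coe.2 ((mem_filter_univ v).2
        ⟨⟨i, hi⟩, u, huq, hlev.symm, hcov.le, le_add_one_of_covBy hcov⟩)

lemma card_le_of_boxIndex_eq_of_light {s : Fin d → ℕ} {q : Fin d → ℕ} {ℓ t : ℕ} (hb : 0 < b)
    {F : Finset V} (hbox : ∀ v ∈ F, lev v = ℓ ∧ boxIndex (b ^ k) s (pos v) = q)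
    (hlight : ∀ p, {v ∈ (F : Set V) | levelBox b c lev pos k v = p}.ncard ≤ t) :
    #F ≤ t * 2 ^ d := by
  classical
  have hB : 0 < b ^ k := pow_pos hb k
  have hlo : ∀ x ∈ F.image pos, ∀ i,
      q i * b ^ k - s i ≤ x i ∧ x i ≤ q i * b ^ k - s i + 1 * b ^ k := by
    refine forall_mem_image.2 fun v hv i => ?_
    have hlow := Nat.div_mul_le_self (pos v i + s i) (b ^ k)
    have hupp := Nat.lt_div_mul_add (a := pos v i + s i) hB
    rw [← (hbox v hv).2, boxIndex]
    omega
  let box := boxIndex (b ^ k) fun _ : Fin d => repdigit c b k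
  calc #F ≤ t * #(F.image (box ∘ pos)) := by
        refine card_le_mul_card_image F t fun p _ => le_trans ?_ (hlight (ℓ, p))
        rw [← Set.ncard_coe_finset]
        refine Set.ncard_le_ncard (fun v hv => ?_) (F.finite_toSet.subset (Set.sep_subset _ _))
        obtain ⟨hvF, hvp⟩ := mem_filter.1 hv
        exact ⟨hvF, Prod.ext (hbox v hvF).1 hvp⟩
    _ ≤ t * 2 ^ d := by
        rw [← image_image]
        gcongr
        simpa using card_image_boxIndex_le hB (fun _ => repdigit c b k) hlo

lemma exists_cut_into_boxes [Finite V] (hB : 0 < b ^ k) {M : ℕ} (hV : Nat.card V ≤ b ^ k * M)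
    (hadj : ∀ u v, G.Adj u v → (orthantGraph d).Adj (pos u) (pos v)) :
    ∃ (S : Set V) (s : Fin d → ℕ), S.ncard ≤ d * M ∧ ∀ u ∉ S, ∀ v ∉ S, G.Adj u v →
      boxIndex (b ^ k) s (pos u) = boxIndex (b ^ k) s (pos v) := by
  classical
  have := Fintype.ofFinite V
  rw [Nat.card_eq_fintype_card] at hV
  choose s hs using fun i => exists_shift_card_dvd_le hB hV fun v => pos v i
  let S : Finset V := univ.biUnion fun i => {v | b ^ k ∣ pos v i + s i + 1}
  have hS : ∀ v ∉ (S : Set V), ∀ i, ¬ b ^ k ∣ pos v i + s i + 1 := fun v hv i hi =>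
    hv (mem_coe.2 (mem_biUnion.2 ⟨i, mem_univ i, (mem_filter_univ v).2 hi⟩))
  refine ⟨S, s, ?_, fun u hu v hv huv => ?_⟩
  · rw [Set.ncard_coe_finset]
    simpa using card_biUnion_le_card_mul univ _ M fun i _ => hs i
  · obtain h | h := orthantGraph_adj_iff_covBy.1 (hadj u v huv)
    · exact boxIndex_eq_of_covBy h (hS u hu)
    · exact (boxIndex_eq_of_covBy h (hS v hv)).symm

lemma exists_separator_of_levelBox [Finite V] (hd : 0 < d) (hac : a + c + 1 = b) (hN : 0 < N)
    (hslice : ∀ i, #(digitSlice d b A m a i) ≤ N) (hpos : Function.Injective pos)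
    (hmem : ∀ v, pos v ∈ spongeVerts d b A m (lev v))
    (hadj : ∀ u v, G.Adj u v → (orthantGraph d).Adj (pos u) (pos v) ∧ lev u = lev v) (k t : ℕ) :
    ∃ T : Set V, T.ncard * (t + 1) ≤ d * (b + 1) ^ d * N ^ k * Nat.card V ∧
      ∀ F : Set V, Disjoint F T → (G.induce F).Preconnected →
        ∀ q, {v ∈ F | levelBox b c lev pos k v = q}.ncard ≤ t := by
  have hzero : ∀ q, {v | levelBox b c lev pos 0 v = q}.ncard ≤ d * (b + 1) ^ d * N ^ k := by
    intro q
    have hone : {v | levelBox b c lev pos 0 v = q}.ncard ≤ 1 :=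
      (Set.ncard_le_one (Set.toFinite _)).2 fun u (hu : _ = q) v (hv : _ = q) =>
        levelBox_zero_injective hpos (hu.trans hv.symm)
    exact hone.trans (Nat.one_le_iff_ne_zero.2 (by positivity))
  have hwall : ∀ j < k, ∀ q, ∃ R : Set V, R.ncard ≤ d * (b + 1) ^ d * N ^ k ∧
      ∀ u v, G.Adj u v → u ∉ R → v ∉ R → levelBox b c lev pos (j + 1) u = q →
        levelBox b c lev pos j u = levelBox b c lev pos j v := by
    intro j hj q
    obtain ⟨R, hR, hwall⟩ := exists_wall hac hN hslice hpos hmem hadj j q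
    exact ⟨R, hR.trans (Nat.mul_le_mul_left _ (Nat.pow_le_pow_right hN hj.le)), hwall⟩
  obtain ⟨T, hTcard, hT⟩ := exists_separator_of_nested_cells (t := t)
    (fun _ _ _ => levelBox_succ_eq_of_levelBox_eq (by omega)) hzero hwall Set.univ
  rw [Set.ncard_univ] at hTcard
  exact ⟨T, hTcard, fun F hFT => hT F fun v hv => ⟨trivial, hFT.notMem_of_mem_left hv⟩⟩

lemma isSeparator_union_of_light [Finite V] (hb : 0 < b) {S T : Set V} {s : Fin d → ℕ} {t : ℕ}
    (hadj : ∀ u v, G.Adj u v → lev u = lev v)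
    (hS : ∀ u ∉ S, ∀ v ∉ S, G.Adj u v → boxIndex (b ^ k) s (pos u) = boxIndex (b ^ k) s (pos v))
    (hT : ∀ F : Set V, Disjoint F T → (G.induce F).Preconnected →
      ∀ q, {v ∈ F | levelBox b c lev pos k v = q}.ncard ≤ t) :
    IsSeparator G ((t : ℝ) * 2 ^ d) (S ∪ T) := by
  intro F hF hconn
  obtain rfl | ⟨w, hw⟩ := F.eq_empty_or_nonempty
  · rw [Set.ncard_empty, Nat.cast_zero]
    positivity
  obtain ⟨hFS, hFT⟩ := Set.disjoint_union_right.1 hF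
  have hbox : ∀ v ∈ F, lev v = lev w ∧ boxIndex (b ^ k) s (pos v) = boxIndex (b ^ k) s (pos w) := by
    refine forall_mem_of_induce_preconnected hconn (fun u hu v hv huv h => ?_) hw ⟨rfl, rfl⟩
    exact ⟨(hadj u v huv).symm.trans h.1, (hS u (hFS.notMem_of_mem_left hu) v
      (hFS.notMem_of_mem_left hv) huv).symm.trans h.2⟩
  have := hT F hFT hconn
  lift F to Finset V using F.toFinite
  rw [Set.ncard_coe_finset]
  exact_mod_cast card_le_of_boxIndex_eq_of_light hb hbox this

theorem cutSize_le_of_card_le_pow [Finite V] (hd : 0 < d) (hac : a + c + 1 = b) (hN : 0 < N)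
    (hslice : ∀ i, #(digitSlice d b A m a i) ≤ N) (hpos : Function.Injective pos)
    (hmem : ∀ v, pos v ∈ spongeVerts d b A m (lev v))
    (hadj : ∀ u v, G.Adj u v → (orthantGraph d).Adj (pos u) (pos v) ∧ lev u = lev v)
    {ε : ℝ} (hε : 0 < ε) (hV : Nat.card V ≤ (b * N) ^ k) :
    (cutSize ε G : ℝ) ≤ (2 ^ d / ε * (d * (b + 1) ^ d) + d) * N ^ k := by
  have hb : 0 < b := by omega
  obtain hV₀ | hV₀ := (Nat.card V).eq_zero_or_pos
  · rw [Nat.le_zero.1 ((cutSize_le_card G hε.le).trans_eq hV₀), Nat.cast_zero]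
    positivity
  set t := ⌊ε * Nat.card V / 2 ^ d⌋₊
  obtain ⟨S, s, hScard, hS⟩ := exists_cut_into_boxes (pow_pos hb k) (hV.trans_eq (mul_pow b N k))
    fun u v huv => (hadj u v huv).1
  obtain ⟨T, hTcard, hT⟩ := exists_separator_of_levelBox hd hac hN hslice hpos hmem hadj k t
  have hsep : IsSeparator G (ε * Nat.card V) (S ∪ T) := fun F hF hconn =>
    (isSeparator_union_of_light hb (fun u v huv => (hadj u v huv).2) hS hT F hF hconn).trans
      ((le_div_iff₀ (by positivity)).1 (Nat.floor_le (by positivity)))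
  have hTreal : (T.ncard : ℝ) ≤ 2 ^ d / ε * (d * (b + 1) ^ d) * N ^ k := by
    have : (0 : ℝ) < Nat.card V := Nat.cast_pos.2 hV₀
    refine le_of_mul_le_mul_right ?_ (by positivity : 0 < ε * Nat.card V / 2 ^ d)
    calc T.ncard * (ε * Nat.card V / 2 ^ d) ≤ T.ncard * ((t : ℝ) + 1) := by
          gcongr
          exact (Nat.lt_floor_add_one _).le
      _ ≤ d * (b + 1) ^ d * N ^ k * Nat.card V := by exact_mod_cast hTcard
      _ = 2 ^ d / ε * (d * (b + 1) ^ d) * N ^ k * (ε * Nat.card V / 2 ^ d) := by field_simp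
  have hSreal : (S.ncard : ℝ) ≤ d * N ^ k := by exact_mod_cast hScard
  calc (cutSize ε G : ℝ) ≤ S.ncard + T.ncard := by
        exact_mod_cast (cutSize_le_ncard hsep).trans (Set.ncard_union_le S T)
    _ ≤ (2 ^ d / ε * (d * (b + 1) ^ d) + d) * N ^ k := by linarith

end UpperBound

section Levels

open Finset

variable {d b m : ℕ} {A : Finset ℕ}

lemma mem_sponge_verts {x : Fin d → ℕ} :
    x ∈ (sponge d b A m).verts ↔ ∃ k, x ∈ spongeVerts d b A m k := by
  simp [sponge, spongeLevel]

lemma sponge_adj {x y : Fin d → ℕ} :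
    (sponge d b A m).Adj x y ↔ ∃ k, x ∈ spongeVerts d b A m k ∧ y ∈ spongeVerts d b A m k ∧
      (orthantGraph d).Adj x y := by
  simp [sponge, spongeLevel]

lemma spongeVerts_mono (hb : 0 < b) (h : 0 ∉ A ∨ d ≤ m) : Monotone (spongeVerts d b A m) := by
  refine monotone_nat_of_le_succ fun k x hx => ⟨fun i => ?_, fun j hj => ?_⟩
  · exact (hx.1 i).trans_le (Nat.pow_le_pow_right hb k.le_succ)
  · obtain h | h := h
    · obtain hj | rfl := Nat.lt_succ_iff_lt_or_eq.1 hj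
      · exact hx.2 j hj
      · simp [Nat.div_eq_of_lt (hx.1 _), h]
    · exact (card_le_univ _).trans (by simpa using h)

lemma le_of_mem_spongeVerts_of_mem_spongeVerts (h0 : 0 ∈ A) (hm : m < d) {x : Fin d → ℕ}
    {k l : ℕ} (hk : x ∈ spongeVerts d b A m k) (hl : x ∈ spongeVerts d b A m l) :
    l ≤ k := by
  refine not_lt.1 fun hkl => (hl.2 k hkl).not_gt ?_
  simpa [Nat.div_eq_of_lt (hk.1 _), h0] using hm

-- Either the sets `V_k` are nested or they are pairwise disjoint.
lemma exists_level {V : Type*} [Finite V] (hb : 0 < b) {G : SimpleGraph V} {pos : V → Fin d → ℕ}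
    (hmem : ∀ v, pos v ∈ (sponge d b A m).verts)
    (hadj : ∀ u v, G.Adj u v → (sponge d b A m).Adj (pos u) (pos v)) :
    ∃ lev : V → ℕ, (∀ v, pos v ∈ spongeVerts d b A m (lev v)) ∧
      ∀ u v, G.Adj u v → (orthantGraph d).Adj (pos u) (pos v) ∧ lev u = lev v := by
  choose lev hlev using fun v => mem_sponge_verts.1 (hmem v)
  by_cases h : 0 ∉ A ∨ d ≤ m
  · obtain ⟨K, hK⟩ := (Set.finite_range lev).bddAbove
    exact ⟨fun _ => K, fun v => spongeVerts_mono hb h (hK ⟨v, rfl⟩) (hlev v), fun u v huv =>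
      ⟨(sponge d b A m).adj_sub (hadj u v huv), rfl⟩⟩
  · push Not at h
    refine ⟨lev, hlev, fun u v huv => ?_⟩
    obtain ⟨k, hu, hv, hcov⟩ := sponge_adj.1 (hadj u v huv)
    have hlev_eq : ∀ w, pos w ∈ spongeVerts d b A m k → lev w = k := fun w hw =>
      (le_of_mem_spongeVerts_of_mem_spongeVerts h.1 h.2 hw (hlev w)).antisymm
        (le_of_mem_spongeVerts_of_mem_spongeVerts h.1 h.2 (hlev w) hw)
    exact ⟨hcov, (hlev_eq u hu).trans (hlev_eq v hv).symm⟩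

end Levels

section Exponent

variable {d b m : ℕ} {A : Finset ℕ}

lemma spongeE_nonneg : 0 ≤ spongeE d b A m :=
  div_nonneg (Real.log_natCast_nonneg _)
    (add_nonneg (Real.log_natCast_nonneg _) (Real.log_natCast_nonneg _))

lemma pow_rpow_spongeE (hb : 1 < b) (hN : 0 < spongeN d b A m) (k : ℕ) :
    (((b * spongeN d b A m) ^ k : ℕ) : ℝ) ^ spongeE d b A m = (spongeN d b A m : ℝ) ^ k := by
  have hN' : (0 : ℝ) < spongeN d b A m := Nat.cast_pos.2 hN
  have hb' : (0 : ℝ) < b := by positivity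
  have : 0 ≤ Real.log (spongeN d b A m) := Real.log_natCast_nonneg _
  have hlogb : 0 < Real.log b := Real.log_pos (Nat.one_lt_cast.2 hb)
  rw [Nat.cast_pow, ← Real.rpow_pow_comm (Nat.cast_nonneg _), Nat.cast_mul,
    Real.rpow_def_of_pos (mul_pos hb' hN'), Real.log_mul hb'.ne' hN'.ne', spongeE,
    add_comm (Real.log b), mul_div_cancel₀ _ (by positivity), Real.exp_log hN']

lemma spongeN_one : spongeN d b A 1 = (b - A.card) ^ (d - 1) := by simp [spongeN]

lemma spongeE_one (hd : 1 ≤ d) (hA : A ⊆ Finset.range b) :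
    spongeE d b A 1 = ((d : ℝ) - 1) * Real.log ((b : ℝ) - A.card) /
        (((d : ℝ) - 1) * Real.log ((b : ℝ) - A.card) + Real.log b) := by
  have hAb : A.card ≤ b := by simpa using Finset.card_le_card hA
  rw [spongeE, spongeN_one, Nat.cast_pow, Real.log_pow, Nat.cast_sub hAb, Nat.cast_sub hd,
    Nat.cast_one]

end Exponent

section UpperProfile

variable {d b m : ℕ} {A : Finset ℕ}

lemma exists_cutSize_coe_le (hd : 0 < d) (hb : 1 < b) (hA : A ⊆ Finset.range b)
    (hN : 0 < spongeN d b A m) {ε : ℝ} (hε : 0 < ε) :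
    ∃ C : ℝ, 0 ≤ C ∧ ∀ G : (sponge d b A m).coe.Subgraph, G.verts.Finite →
      (cutSize ε G.coe : ℝ) ≤ C * (G.verts.ncard : ℝ) ^ spongeE d b A m := by
  have hb₀ : 0 < b := by omega
  obtain ⟨a, hab, hslice⟩ := exists_card_digitSlice_le (d := d) hb₀ hA (pos_of_spongeN_pos hN)
  obtain ⟨c, hc⟩ := Nat.exists_eq_add_of_lt hab
  set N := spongeN d b A m
  set C₀ : ℝ := 2 ^ d / ε * (d * (b + 1) ^ d) + d
  refine ⟨C₀ * N, by positivity, fun G hG => ?_⟩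
  have : Finite G.verts := hG
  have hE : 0 ≤ spongeE d b A m := spongeE_nonneg
  have hbN : 1 < b * N := hb.trans_le (Nat.le_mul_of_pos_right b hN)
  obtain ⟨lev, hlev, hadj⟩ := exists_level hb₀ (G := G.coe) (pos := fun v => v.1.1)
    (fun v => v.1.2) fun u v huv => G.coe_adj_sub u v huv
  obtain hV₀ | hV₀ := (Nat.card G.verts).eq_zero_or_pos
  · rw [Nat.le_zero.1 ((cutSize_le_card G.coe hε.le).trans_eq hV₀), Nat.cast_zero]
    positivity
  set k := Nat.log (b * N) (Nat.card G.verts)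
  calc (cutSize ε G.coe : ℝ) ≤ C₀ * N ^ (k + 1) :=
        cutSize_le_of_card_le_pow hd hc.symm hN hslice
          (Subtype.val_injective.comp Subtype.val_injective) hlev hadj hε
          (Nat.lt_pow_succ_log_self hbN _).le
    _ = C₀ * N * (N : ℝ) ^ k := by ring
    _ = C₀ * N * (((b * N) ^ k : ℕ) : ℝ) ^ spongeE d b A m := by rw [pow_rpow_spongeE hb hN]
    _ ≤ C₀ * N * (G.verts.ncard : ℝ) ^ spongeE d b A m := by
        gcongr
        exact Nat.pow_le_of_le_log hV₀.ne' le_rfl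

theorem sepProfile_isBigO_rpow_spongeE (hd : 0 < d) (hb : 1 < b) (hA : A ⊆ Finset.range b)
    (hN : 0 < spongeN d b A m) {ε : ℝ} (hε : 0 < ε) :
    (fun n : ℕ => (sepProfile ε (sponge d b A m).coe n : ℝ)) =O[atTop]
      fun n : ℕ => (n : ℝ) ^ spongeE d b A m := by
  obtain ⟨C, hC, hcut⟩ := exists_cutSize_coe_le hd hb hA hN hε
  have hE : 0 ≤ spongeE d b A m := spongeE_nonneg
  refine IsBigO.of_bound C (Eventually.of_forall fun n => ?_)
  rw [Real.norm_of_nonneg (Nat.cast_nonneg _), Real.norm_of_nonneg (by positivity)]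
  have hfloor : sepProfile ε (sponge d b A m).coe n ≤ ⌊C * (n : ℝ) ^ spongeE d b A m⌋₊ := by
    refine csSup_le' ?_
    rintro _ ⟨G, hG, hn, rfl⟩
    exact Nat.le_floor ((hcut G hG).trans (by gcongr))
  exact (Nat.cast_le.2 hfloor).trans (Nat.floor_le (by positivity))

end UpperProfile

section Paths

open Function

lemma spanningCoe_induce_adj {V : Type*} {G : SimpleGraph V} {W : Set V} {u v : V} :
    (G.induce W).spanningCoe.Adj u v ↔ G.Adj u v ∧ u ∈ W ∧ v ∈ W := by
  simp

lemma preconnected_induce_supp_inter {V : Type*} {G : SimpleGraph V} {W : Set V}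
    (c : (G.induce W).spanningCoe.ConnectedComponent) : (G.induce (c.supp ∩ W)).Preconnected := by
  obtain hempty | ⟨w, hwc, hwW⟩ := (c.supp ∩ W).eq_empty_or_nonempty
  · rw [hempty]
    exact fun v => v.2.elim
  have hsub : c.supp ⊆ W := by
    intro v hv
    obtain ⟨p⟩ := SimpleGraph.ConnectedComponent.exact (hv.trans hwc.symm)
    cases p with
    | nil => exact hwW
    | cons h _ => exact (spanningCoe_induce_adj.1 h).2.1
  rw [Set.inter_eq_left.2 hsub]
  exact c.connected_toSimpleGraph.preconnected.mono
    (SimpleGraph.comap_monotone _ (G.spanningCoe_induce_le W))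

variable {ι : Type*} {B : ℕ} {W : Set (ι → ℕ)} {H : SimpleGraph (ι → ℕ)} {ρ : ι → ℕ}
  {x y : ι → ℕ}

lemma reachable_update_of_forall_mem [DecidableEq ι]
    (hH : ∀ u ∈ W, ∀ v ∈ W, u ⋖ v → H.Adj u v) {p : ι → ℕ} {i : ι}
    (hp : ∀ r < B, update p i r ∈ W) {r t : ℕ} (hr : r < B) (ht : t < B) :
    H.Reachable (update p i r) (update p i t) := by
  have hzero : ∀ r < B, H.Reachable (update p i 0) (update p i r) := by
    intro r
    induction r with
    | zero => exact fun _ => SimpleGraph.Reachable.refl _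
    | succ r ih =>
      refine fun hr => (ih (Nat.lt_of_succ_lt hr)).trans (SimpleGraph.Adj.reachable ?_)
      refine hH _ (hp r (Nat.lt_of_succ_lt hr)) _ (hp (r + 1) hr) (Pi.covBy_iff.2 ⟨i, ?_, ?_⟩)
      · simp
      · intro j hj
        simp [hj]
  exact (hzero r hr).symm.trans (hzero t ht)

/-- The intermediate point on the axis-parallel path from `x` to `y` which moves the coordinates
in the order of their ranks `ρ`, just before the coordinates of rank `n` or more are moved. -/
def splice (ρ x y : ι → ℕ) (n : ℕ) : ι → ℕ := fun i => if ρ i < n then y i else x i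

lemma splice_eq_update [DecidableEq ι] (ρ x y : ι → ℕ) (i : ι) :
    splice ρ x y (ρ i) = update (splice ρ x y (ρ i)) i (x i) := by
  simp [splice]

lemma splice_succ_eq_update [DecidableEq ι] (hρ : Injective ρ) (x y : ι → ℕ) (i : ι) :
    splice ρ x y (ρ i + 1) = update (splice ρ x y (ρ i)) i (y i) := by
  funext j
  obtain rfl | hj := eq_or_ne j i
  · simp [splice]
  · simp [splice, hj, le_iff_lt_or_eq, hρ.ne hj]

lemma reachable_of_forall_splice_mem [Finite ι] [DecidableEq ι]
    (hH : ∀ u ∈ W, ∀ v ∈ W, u ⋖ v → H.Adj u v) (hρ : Injective ρ) (hx : ∀ i, x i < B)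
    (hy : ∀ i, y i < B) (hW : ∀ i, ∀ r < B, update (splice ρ x y (ρ i)) i r ∈ W) :
    H.Reachable x y := by
  have hsplice : ∀ n, H.Reachable x (splice ρ x y n) := by
    intro n
    induction n with
    | zero => exact SimpleGraph.Reachable.refl _
    | succ n ih =>
      refine ih.trans ?_
      by_cases hn : ∃ i, ρ i = n
      · obtain ⟨i, rfl⟩ := hn
        rw [splice_succ_eq_update hρ, splice_eq_update, update_idem]
        exact reachable_update_of_forall_mem hH (hW i) (hx i) (hy i)
      · push Not at hn
        have hsame : splice ρ x y (n + 1) = splice ρ x y n :=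
          funext fun i => by simp [splice, le_iff_lt_or_eq, hn i]
        rw [hsame]
  obtain ⟨M, hM⟩ := (Set.finite_range ρ).bddAbove
  have hend : splice ρ x y (M + 1) = y :=
    funext fun i => if_pos (Nat.lt_succ_of_le (hM ⟨i, rfl⟩))
  exact hend ▸ hsplice (M + 1)

/-- Some point of `T` lies on one of the lines along which the path described at `splice` moves. -/
def PathHits (ρ : ι → ℕ) (T : Set (ι → ℕ)) (x y : ι → ℕ) : Prop :=
  ∃ i, ∃ s ∈ T, ∀ l ≠ i, s l = splice ρ x y (ρ i) l

end Paths

section LineGrid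

open Finset

variable {d B : ℕ} {C : Finset ℕ} {ρ : Fin d → ℕ}

/-- The union of the lines of `[0, B)^d` in direction `i` whose other coordinates lie in `C`. -/
def lineFamily (d B : ℕ) (C : Finset ℕ) (i : Fin d) : Finset (Fin d → ℕ) :=
  Fintype.piFinset fun l => if l = i then range B else C

/-- The grid of lines on which the lower bound is proved: all coordinates but one lie in `C`. -/
def lineGrid (d B : ℕ) (C : Finset ℕ) : Finset (Fin d → ℕ) := univ.biUnion (lineFamily d B C)

lemma mem_lineFamily {i : Fin d} {x : Fin d → ℕ} :
    x ∈ lineFamily d B C i ↔ x i < B ∧ ∀ l ≠ i, x l ∈ C := by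
  refine Fintype.mem_piFinset.trans ⟨fun h => ⟨by simpa using h i, fun l hl => ?_⟩, fun h l => ?_⟩
  · simpa [hl] using h l
  · split_ifs with hl
    · exact mem_range.2 (hl ▸ h.1)
    · exact h.2 l hl

lemma mem_lineGrid {x : Fin d → ℕ} : x ∈ lineGrid d B C ↔ ∃ i, x i < B ∧ ∀ l ≠ i, x l ∈ C := by
  simp only [lineGrid, mem_biUnion, mem_univ, true_and, mem_lineFamily]

lemma card_lineFamily (i : Fin d) : #(lineFamily d B C i) = B * #C ^ (d - 1) := by
  simp [lineFamily, Fintype.card_piFinset, apply_ite card, prod_ite, filter_eq', filter_ne',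
    card_erase_of_mem]

lemma card_lineGrid_le : #(lineGrid d B C) ≤ d * (B * #C ^ (d - 1)) := by
  simpa [lineGrid] using card_biUnion_le_card_mul univ (lineFamily d B C) _
    fun i _ => (card_lineFamily i).le

lemma le_card_lineGrid (hd : 0 < d) : B * #C ^ (d - 1) ≤ #(lineGrid d B C) := by
  rw [← card_lineFamily ⟨0, hd⟩]
  exact card_le_card (subset_biUnion_of_mem (lineFamily d B C) (mem_univ _))

lemma update_splice_mem_lineGrid {i : Fin d} {x v : Fin d → ℕ} (hρ : ∀ l ≠ i, ρ l < ρ i)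
    (hx : ∀ l, x l ∈ C) (hv : v ∈ lineFamily d B C i) (j : Fin d) {r : ℕ} (hr : r < B) :
    Function.update (splice ρ x v (ρ j)) j r ∈ lineGrid d B C := by
  refine mem_lineGrid.2 ⟨j, by simpa using hr, fun l hl => ?_⟩
  rw [Function.update_of_ne hl, splice]
  split_ifs with hlj
  · refine (mem_lineFamily.1 hv).2 l ?_
    rintro rfl
    exact (hρ j hl.symm).not_gt hlj
  · exact hx l

lemma card_piFinset_mul_card_piFinset_le {ι : Type*} [Fintype ι] [DecidableEq ι] {ρ : ι → ℕ}
    (hρ : Function.Injective ρ) {D : ι → Finset ℕ} (hD : ∀ l, #C ≤ #(D l)) (j : ι) (s : ι → ℕ) :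
    #(Fintype.piFinset fun l => if ρ j < ρ l then {s l} else C) *
      #(Fintype.piFinset fun l => if ρ l < ρ j then {s l} else D l) ≤ #C * ∏ l, #(D l) := by
  rw [Fintype.card_piFinset, Fintype.card_piFinset, ← prod_mul_distrib,
    ← mul_prod_erase univ _ (mem_univ j), ← mul_prod_erase univ (fun l => #(D l)) (mem_univ j),
    ← mul_assoc]
  refine Nat.mul_le_mul (by simp) (prod_le_prod' fun l hl => ?_)
  obtain hlj | hlj := (hρ.ne (ne_of_mem_erase hl)).lt_or_gt
  · simpa [hlj, hlj.not_gt] using hD l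
  · simp [hlj, hlj.not_gt]

open Classical in
-- If `s` lies on a line in direction `j` through a point of the path, its coordinates other than
-- the `j`-th are those of `v` where the rank is below `ρ j` and those of `x` where it is above.
lemma card_filter_pathHits_le (hCB : C ⊆ range B) (hρ : Function.Injective ρ)
    (T : Finset (Fin d → ℕ)) (i : Fin d) :
    #{z ∈ (Fintype.piFinset fun _ : Fin d => C) ×ˢ lineFamily d B C i | PathHits ρ T z.1 z.2} ≤
      d * #T * (#C * (B * #C ^ (d - 1))) := by
  let D (l : Fin d) : Finset ℕ := if l = i then range B else C
  have hD : ∀ l, #C ≤ #(D l) := fun l => by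
    simp only [D]
    split_ifs
    exacts [card_le_card hCB, le_rfl]
  let X (j : Fin d) (s : Fin d → ℕ) (l : Fin d) : Finset ℕ := if ρ j < ρ l then {s l} else C
  let Y (j : Fin d) (s : Fin d → ℕ) (l : Fin d) : Finset ℕ := if ρ l < ρ j then {s l} else D l
  have hcover :
      {z ∈ (Fintype.piFinset fun _ : Fin d => C) ×ˢ lineFamily d B C i | PathHits ρ T z.1 z.2} ⊆
        (univ ×ˢ T).biUnion fun js =>
          Fintype.piFinset (X js.1 js.2) ×ˢ Fintype.piFinset (Y js.1 js.2) := by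
    rintro ⟨x, v⟩ hz
    obtain ⟨hz, j, s, hs, h⟩ := mem_filter.1 hz
    obtain ⟨hx, hv⟩ := mem_product.1 hz
    refine mem_biUnion.2 ⟨(j, s), mem_product.2 ⟨mem_univ j, hs⟩, mem_product.2
      ⟨Fintype.mem_piFinset.2 fun l => ?_, Fintype.mem_piFinset.2 fun l => ?_⟩⟩
    · simp only [X]
      split_ifs with hl
      · simp [h l (fun h => by simp [h] at hl), splice, hl.not_gt]
      · exact Fintype.mem_piFinset.1 hx l
    · simp only [Y]
      split_ifs with hl
      · simp [h l (fun h => by simp [h] at hl), splice, hl]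
      · exact Fintype.mem_piFinset.1 hv l
  have hcard : ∀ js ∈ (univ : Finset (Fin d)) ×ˢ T,
      #(Fintype.piFinset (X js.1 js.2) ×ˢ Fintype.piFinset (Y js.1 js.2)) ≤
        #C * (B * #C ^ (d - 1)) := fun js _ => by
    rw [card_product, ← card_lineFamily i, lineFamily,
      Fintype.card_piFinset fun l => if l = i then range B else C]
    exact card_piFinset_mul_card_piFinset_le hρ hD js.1 js.2
  simpa using (card_le_card hcover).trans (card_biUnion_le_card_mul _ _ _ hcard)

/-- The order in which a path towards a line in direction `i` moves the coordinates: the `i`-th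
one last, so that the path stays in the grid of lines. -/
def rankLast (i l : Fin d) : ℕ := if l = i then d else l

lemma rankLast_injective (i : Fin d) : Function.Injective (rankLast i) := by
  intro l l' h
  simp only [rankLast] at h
  split_ifs at h <;> omega

lemma rankLast_lt {i l : Fin d} (hl : l ≠ i) : rankLast i l < rankLast i i := by
  simp [rankLast, hl]

lemma reachable_of_not_pathHits {H : SimpleGraph (Fin d → ℕ)} {T : Finset (Fin d → ℕ)}
    (hH : ∀ u ∈ lineGrid d B C \ T, ∀ v ∈ lineGrid d B C \ T, u ⋖ v → H.Adj u v)
    (hCB : C ⊆ range B) {i : Fin d} {x v : Fin d → ℕ} (hx : ∀ l, x l ∈ C)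
    (hv : v ∈ lineFamily d B C i) (hhits : ¬ PathHits (rankLast i) T x v) : H.Reachable x v := by
  have hxB : ∀ l, x l < B := fun l => mem_range.1 (hCB (hx l))
  have hvB : ∀ l, v l < B := fun l => by
    obtain rfl | hl := eq_or_ne l i
    · exact (mem_lineFamily.1 hv).1
    · exact mem_range.1 (hCB ((mem_lineFamily.1 hv).2 l hl))
  refine reachable_of_forall_splice_mem (W := (lineGrid d B C \ T : Finset (Fin d → ℕ))) hH
    (rankLast_injective i) hxB hvB fun j r hr => mem_sdiff.2 ⟨?_, fun hT => ?_⟩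
  · exact update_splice_mem_lineGrid (fun _ => rankLast_lt) hx hv j hr
  · exact hhits ⟨j, _, hT, fun l hl => Function.update_of_ne hl _ _⟩

open Classical in
lemma exists_sum_card_pathHits_le (hC : C.Nonempty) (hCB : C ⊆ range B) (T : Finset (Fin d → ℕ)) :
    ∃ x : Fin d → ℕ, (∀ l, x l ∈ C) ∧
      ∑ i, #{v ∈ lineFamily d B C i | PathHits (rankLast i) T x v} ≤ d ^ 2 * #T * B := by
  let P : Finset (Fin d → ℕ) := Fintype.piFinset fun _ => C
  have hsum : ∑ x ∈ P, ∑ i, #{v ∈ lineFamily d B C i | PathHits (rankLast i) T x v} ≤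
      ∑ _x ∈ P, d ^ 2 * #T * B := by
    calc ∑ x ∈ P, ∑ i, #{v ∈ lineFamily d B C i | PathHits (rankLast i) T x v}
        = ∑ i, ∑ x ∈ P,
            #{v ∈ lineFamily d B C i | PathHits (rankLast i) T x v} := sum_comm
      _ = ∑ i, #{z ∈ P ×ˢ lineFamily d B C i |
            PathHits (rankLast i) T z.1 z.2} := by simp only [card_filter, sum_product]
      _ ≤ ∑ _i : Fin d, d * #T * (#C * (B * #C ^ (d - 1))) :=
          sum_le_sum fun i _ => card_filter_pathHits_le hCB (rankLast_injective i) T i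
      _ = ∑ _x ∈ P, d ^ 2 * #T * B := by
          obtain rfl | hd := d.eq_zero_or_pos
          · simp
          · simp only [P, sum_const, card_univ, Fintype.card_fin, Fintype.card_piFinset, prod_const,
              smul_eq_mul]
            rw [← mul_pow_sub_one hd.ne' #C]
            ring
  obtain ⟨x, hx, hle⟩ := exists_le_of_sum_le (Fintype.piFinset_nonempty.2 fun _ => hC) hsum
  exact ⟨x, Fintype.mem_piFinset.1 hx, hle⟩

end LineGrid

section Grid

open Finset

variable {d B : ℕ} {C : Finset ℕ}

theorem exists_preconnected_card_lineGrid_le (hC : C.Nonempty) (hCB : C ⊆ range B)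
    (T : Finset (Fin d → ℕ)) :
    ∃ F : Set (Fin d → ℕ), F ⊆ lineGrid d B C ∧ Disjoint F T ∧
      ((orthantGraph d).induce F).Preconnected ∧
      #(lineGrid d B C) ≤ F.ncard + d ^ 2 * #T * B := by
  classical
  obtain ⟨x, hx, hbad⟩ := exists_sum_card_pathHits_le hC hCB T
  set W : Finset (Fin d → ℕ) := lineGrid d B C \ T
  set H := ((orthantGraph d).induce W).spanningCoe
  set F := (H.connectedComponentMk x).supp ∩ W
  have hFW : F ⊆ W := Set.inter_subset_right
  refine ⟨F, hFW.trans (coe_subset.2 sdiff_subset), (disjoint_coe.2 sdiff_disjoint).mono_left hFW,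
    preconnected_induce_supp_inter _, ?_⟩
  have hH : ∀ u ∈ W, ∀ v ∈ W, u ⋖ v → H.Adj u v := fun u hu v hv h =>
    spanningCoe_induce_adj.2 ⟨orthantGraph_adj_iff_covBy.2 (Or.inl h), hu, hv⟩
  have hgood : ∀ i, ∀ v ∈ lineFamily d B C i, ¬ PathHits (rankLast i) T x v → v ∈ F := by
    intro i v hv hhits
    have hvgrid : v ∈ lineGrid d B C := mem_biUnion.2 ⟨i, mem_univ i, hv⟩
    have hvT : v ∉ T := fun hvT => hhits ⟨i, v, hvT, fun l hl => by simp [splice, rankLast_lt hl]⟩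
    have hreach : H.Reachable x v := reachable_of_not_pathHits hH hCB hx hv hhits
    exact ⟨(SimpleGraph.ConnectedComponent.sound hreach).symm, mem_sdiff.2 ⟨hvgrid, hvT⟩⟩
  let bad (i : Fin d) := {v ∈ lineFamily d B C i | PathHits (rankLast i) T x v}
  have hcover : (lineGrid d B C : Set (Fin d → ℕ)) ⊆ F ∪ univ.biUnion bad := by
    intro v hv
    obtain ⟨i, -, hi⟩ := mem_biUnion.1 hv
    by_cases hhits : PathHits (rankLast i) T x v
    · exact Or.inr (mem_biUnion.2 ⟨i, mem_univ i, mem_filter.2 ⟨hi, hhits⟩⟩)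
    · exact Or.inl (hgood i v hi hhits)
  calc #(lineGrid d B C) ≤ (F ∪ univ.biUnion bad).ncard := by
        rw [← Set.ncard_coe_finset]
        exact Set.ncard_le_ncard hcover ((W.finite_toSet.subset hFW).union (finite_toSet _))
    _ ≤ F.ncard + #(univ.biUnion bad) := by
        simpa only [Set.ncard_coe_finset] using Set.ncard_union_le F (univ.biUnion bad)
    _ ≤ F.ncard + d ^ 2 * #T * B := by
        gcongr
        exact card_biUnion_le.trans hbad

lemma IsSeparator.ncard_le_of_subset {V : Type*} {G : SimpleGraph V} {U F : Set V} {L : ℝ}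
    {S : Set U} (hS : IsSeparator (G.induce U) L S) (hFU : F ⊆ U)
    (hFS : Disjoint F (Subtype.val '' S)) (hF : (G.induce F).Preconnected) : F.ncard ≤ L := by
  have hdisj : Disjoint (Subtype.val ⁻¹' F : Set U) S := Set.disjoint_left.2 fun v hvF hvS =>
    Set.disjoint_left.1 hFS hvF ⟨v, hvS, rfl⟩
  have hconn : ((G.induce U).induce (Subtype.val ⁻¹' F)).Preconnected := by
    let f : G.induce F →g (G.induce U).induce (Subtype.val ⁻¹' F) :=
      ⟨fun v => ⟨⟨v, hFU v.2⟩, v.2⟩, id⟩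
    exact hF.map f fun v => ⟨⟨v, v.2⟩, rfl⟩
  rw [← Set.ncard_preimage_of_injective_subset_range Subtype.val_injective
    (hFU.trans Subtype.range_coe.superset)]
  exact hS _ hdisj hconn

theorem le_cutSize_induce_lineGrid (hd : 0 < d) (hB : 0 < B) (hC : C.Nonempty) (hCB : C ⊆ range B)
    {ε : ℝ} (hε₀ : 0 ≤ ε) (hε₁ : ε ≤ 1) :
    (1 - ε) * (#C : ℝ) ^ (d - 1) ≤
      d ^ 2 * cutSize ε ((orthantGraph d).induce (lineGrid d B C : Set (Fin d → ℕ))) := by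
  set U : Set (Fin d → ℕ) := (lineGrid d B C : Set (Fin d → ℕ))
  set G := (orthantGraph d).induce U
  have : Finite U := finite_toSet _
  have hU : Nat.card U = #(lineGrid d B C) := by simp [U]
  obtain ⟨S, hS, hScard⟩ := exists_isSeparator_ncard_eq_cutSize G hε₀
  let T : Finset (Fin d → ℕ) := ((S.toFinite.image Subtype.val).toFinset)
  have hT : (T : Set (Fin d → ℕ)) = Subtype.val '' S := Set.Finite.coe_toFinset _
  have hTcard : #T = cutSize ε G := by
    rw [← hScard, ← Set.ncard_coe_finset, hT, Set.ncard_image_of_injective _ Subtype.val_injective]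
  obtain ⟨F, hFU, hFT, hconn, hcard⟩ := exists_preconnected_card_lineGrid_le hC hCB T
  have hF : (F.ncard : ℝ) ≤ ε * #(lineGrid d B C) := by
    rw [← hU]
    exact hS.ncard_le_of_subset hFU (hT ▸ hFT) hconn
  have hcard' : (#(lineGrid d B C) : ℝ) ≤ F.ncard + d ^ 2 * cutSize ε G * B := by
    rw [← hTcard]
    exact_mod_cast hcard
  have hlow : (B * #C ^ (d - 1) : ℝ) ≤ #(lineGrid d B C) := by
    exact_mod_cast le_card_lineGrid hd
  refine le_of_mul_le_mul_right ?_ (Nat.cast_pos.2 hB : (0 : ℝ) < B)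
  calc (1 - ε) * (#C : ℝ) ^ (d - 1) * B = (1 - ε) * (B * #C ^ (d - 1)) := by ring
    _ ≤ (1 - ε) * #(lineGrid d B C) := by gcongr
    _ ≤ d ^ 2 * cutSize ε G * B := by linarith

end Grid

section SpongeLowerBound

open Finset

variable {d b : ℕ} {A : Finset ℕ}

/-- The numbers with `k` digits in base `b`, none of which lies in `A`; leading zeros count as
digits. -/
def avoidingNumbers (b : ℕ) (A : Finset ℕ) (k : ℕ) : Finset ℕ :=
  {x ∈ range (b ^ k) | ∀ j < k, x / b ^ j % b ∉ A}

lemma mem_avoidingNumbers {k x : ℕ} :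
    x ∈ avoidingNumbers b A k ↔ x < b ^ k ∧ ∀ j < k, x / b ^ j % b ∉ A := by
  simp [avoidingNumbers]

lemma mem_avoidingNumbers_succ (hb : 0 < b) {k x : ℕ} :
    x ∈ avoidingNumbers b A (k + 1) ↔ x / b ∈ avoidingNumbers b A k ∧ x % b ∉ A := by
  simp only [mem_avoidingNumbers, Nat.div_lt_iff_lt_mul hb, ← pow_succ, Nat.div_div_eq_div_mul,
    ← pow_succ', Nat.forall_lt_succ_left, pow_zero, Nat.div_one]
  tauto

lemma card_avoidingNumbers (hb : 0 < b) (hA : A ⊆ range b) (k : ℕ) :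
    #(avoidingNumbers b A k) = (b - #A) ^ k := by
  induction k with
  | zero => simp [avoidingNumbers]
  | succ k ih =>
    have hprod : #(avoidingNumbers b A (k + 1)) = #(avoidingNumbers b A k ×ˢ (range b \ A)) := by
      refine card_nbij' (fun x => (x / b, x % b)) (fun z => b * z.1 + z.2) (fun x hx => ?_)
        (fun ⟨y, c⟩ hz => ?_) (fun x _ => Nat.div_add_mod x b) (fun ⟨y, c⟩ hz => ?_)
      · obtain ⟨hdiv, hmod⟩ := (mem_avoidingNumbers_succ hb).1 hx
        simp [hdiv, hmod, Nat.mod_lt _ hb]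
      · obtain ⟨hy, hc⟩ := mem_product.1 hz
        have hcb : c < b := mem_range.1 (mem_sdiff.1 hc).1
        refine (mem_avoidingNumbers_succ hb).2 ?_
        simpa [Nat.mul_add_div hb, Nat.div_eq_of_lt hcb, Nat.mod_eq_of_lt hcb] using
          And.intro hy (mem_sdiff.1 hc).2
      · have hcb : c < b := mem_range.1 (mem_sdiff.1 (mem_product.1 hz).2).1
        simp [Nat.mul_add_div hb, Nat.div_eq_of_lt hcb, Nat.mod_eq_of_lt hcb]
    rw [hprod, card_product, ih, card_sdiff_of_subset hA, card_range, pow_succ]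

lemma lineGrid_subset_spongeVerts (k : ℕ) :
    (lineGrid d (b ^ k) (avoidingNumbers b A k) : Set (Fin d → ℕ)) ⊆ spongeVerts d b A 1 k := by
  intro x hx
  obtain ⟨i, hi, hC⟩ := mem_lineGrid.1 hx
  refine ⟨fun l => ?_, fun j hj => ?_⟩
  · obtain rfl | hl := eq_or_ne l i
    · exact hi
    · exact (mem_avoidingNumbers.1 (hC l hl)).1
  · refine (card_le_card (t := {i}) fun l hl => mem_singleton.2 ?_).trans (card_singleton i).le
    by_contra hli
    exact (mem_avoidingNumbers.1 (hC l hli)).2 j hj (mem_filter.1 hl).2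

/-- The copy in the sponge of the lattice graph induced on a subset of one of its levels. -/
def spongeCopy {m k : ℕ} {U : Set (Fin d → ℕ)} (hU : U ⊆ spongeVerts d b A m k) :
    SimpleGraph.Copy ((orthantGraph d).induce U) (sponge d b A m).coe where
  toHom := ⟨fun v => ⟨v, mem_sponge_verts.2 ⟨k, hU v.2⟩⟩,
    fun {u v} h => sponge_adj.2 ⟨k, hU u.2, hU v.2, h⟩⟩
  injective' _ _ h := Subtype.ext (Subtype.mk.inj h)

lemma mul_pow_le_sepProfile_sponge (hd : 2 ≤ d) (hb : 0 < b) (hA : A ⊆ range b)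
    (hN : 0 < spongeN d b A 1) {ε : ℝ} (hε₀ : 0 ≤ ε) (hε₁ : ε ≤ 1) {n k : ℕ}
    (hn : d * (b * spongeN d b A 1) ^ k ≤ n) :
    (1 - ε) * (spongeN d b A 1 : ℝ) ^ k ≤ d ^ 2 * sepProfile ε (sponge d b A 1).coe n := by
  set C := avoidingNumbers b A k
  have hCN : #C ^ (d - 1) = spongeN d b A 1 ^ k := by
    rw [card_avoidingNumbers hb hA, spongeN_one, pow_right_comm]
  have hC : C.Nonempty := by
    have hpos : 0 < #C ^ (d - 1) := hCN ▸ pow_pos hN k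
    exact card_pos.1 (Nat.pos_of_ne_zero fun h0 => by simp [h0, show d - 1 ≠ 0 by omega] at hpos)
  have hcard : Nat.card (lineGrid d (b ^ k) C : Set (Fin d → ℕ)) ≤ n := by
    rw [Nat.card_coe_set_eq, Set.ncard_coe_finset]
    refine card_lineGrid_le.trans ?_
    rwa [hCN, ← mul_pow]
  calc (1 - ε) * (spongeN d b A 1 : ℝ) ^ k = (1 - ε) * (#C : ℝ) ^ (d - 1) := by
        rw [← Nat.cast_pow, ← hCN, Nat.cast_pow]
    _ ≤ d ^ 2 * cutSize ε ((orthantGraph d).induce (lineGrid d (b ^ k) C : Set (Fin d → ℕ))) :=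
        le_cutSize_induce_lineGrid (by omega) (by positivity) hC (filter_subset _ _) hε₀ hε₁
    _ ≤ d ^ 2 * sepProfile ε (sponge d b A 1).coe n := by
        gcongr
        exact cutSize_le_sepProfile (spongeCopy (lineGrid_subset_spongeVerts k)) hε₀ hcard

theorem rpow_spongeE_isBigO_sepProfile (hd : 2 ≤ d) (hb : 1 < b) (hA : A ⊆ range b)
    (hN : 0 < spongeN d b A 1) {ε : ℝ} (hε₀ : 0 ≤ ε) (hε₁ : ε < 1) :
    (fun n : ℕ => (n : ℝ) ^ spongeE d b A 1) =O[atTop]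
      fun n : ℕ => (sepProfile ε (sponge d b A 1).coe n : ℝ) := by
  set N := spongeN d b A 1
  set E := spongeE d b A 1
  have hE : 0 ≤ E := spongeE_nonneg
  have hε : 0 < 1 - ε := sub_pos.2 hε₁
  have hbN : 1 < b * N := hb.trans_le (Nat.le_mul_of_pos_right _ hN)
  refine IsBigO.of_bound ((d : ℝ) ^ E * N * (d ^ 2 / (1 - ε)))
    (eventually_atTop.2 ⟨d, fun n hn => ?_⟩)
  rw [Real.norm_of_nonneg (by positivity), Real.norm_of_nonneg (Nat.cast_nonneg _)]
  set k := Nat.log (b * N) (n / d)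
  have hlow : d * (b * N) ^ k ≤ n :=
    (Nat.mul_le_mul_left d (Nat.pow_log_le_self _ (Nat.div_pos hn (by omega)).ne')).trans
      (Nat.mul_div_le n d)
  have hupp : n ≤ d * (b * N) ^ (k + 1) :=
    ((Nat.div_lt_iff_lt_mul (by omega)).1 (Nat.lt_pow_succ_log_self hbN _)).le.trans_eq
      (mul_comm _ _)
  have hsep : (N : ℝ) ^ k ≤ d ^ 2 / (1 - ε) * sepProfile ε (sponge d b A 1).coe n := by
    rw [div_mul_eq_mul_div, le_div_iff₀ hε, mul_comm]
    exact mul_pow_le_sepProfile_sponge hd (by omega) hA hN hε₀ hε₁.le hlow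
  calc (n : ℝ) ^ E ≤ ((d * (b * N) ^ (k + 1) : ℕ) : ℝ) ^ E := by gcongr
    _ = (d : ℝ) ^ E * N * (N : ℝ) ^ k := by
        rw [Nat.cast_mul, Real.mul_rpow (by positivity) (by positivity), pow_rpow_spongeE hb hN]
        ring
    _ ≤ (d : ℝ) ^ E * N * (d ^ 2 / (1 - ε) * sepProfile ε (sponge d b A 1).coe n) := by gcongr
    _ = (d : ℝ) ^ E * N * (d ^ 2 / (1 - ε)) * sepProfile ε (sponge d b A 1).coe n := by ring

end SpongeLowerBound

theorem theorem2_general (d b m : ℕ) (A : Finset ℕ) (hd : 2 ≤ d) (hb : 2 ≤ b)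
    (hA : A ⊆ Finset.range b) (hN : 0 < spongeN d b A m)
    (ε : ℝ) (hε0 : 0 < ε) (hε1 : ε < 1) :
    ((fun n : ℕ => (sepProfile ε (sponge d b A m).coe n : ℝ)) =O[atTop]
        fun n : ℕ => (n : ℝ) ^ spongeE d b A m) ∧
    (m = 1 →
      spongeE d b A m = ((d : ℝ) - 1) * Real.log ((b : ℝ) - A.card) /
        (((d : ℝ) - 1) * Real.log ((b : ℝ) - A.card) + Real.log b) ∧
      (fun n : ℕ => (sepProfile ε (sponge d b A m).coe n : ℝ)) =Θ[atTop]
        fun n : ℕ => (n : ℝ) ^ spongeE d b A m) := by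
  have hupper := sepProfile_isBigO_rpow_spongeE (by omega) hb hA hN hε0
  refine ⟨hupper, ?_⟩
  rintro rfl
  exact ⟨spongeE_one (by omega) hA, hupper, rpow_spongeE_isBigO_sepProfile hd hb hA hN hε0.le hε1⟩

theorem theorem2 (d b m : ℕ) (A : Finset ℕ) (hd : 2 ≤ d) (hb : 3 ≤ b)
    (hA : A ⊆ Finset.range b) (hm : m ≤ d) (hN : 0 < spongeN d b A m)
    (ε : ℝ) (hε0 : 0 < ε) (hε1 : ε < 1) :
    ((fun n : ℕ => (sepProfile ε (sponge d b A m).coe n : ℝ)) =O[atTop]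
        fun n : ℕ => (n : ℝ) ^ spongeE d b A m) ∧
    (m = 1 →
      spongeE d b A m = ((d : ℝ) - 1) * Real.log ((b : ℝ) - A.card) /
        (((d : ℝ) - 1) * Real.log ((b : ℝ) - A.card) + Real.log b) ∧
      (fun n : ℕ => (sepProfile ε (sponge d b A m).coe n : ℝ)) =Θ[atTop]
        fun n : ℕ => (n : ℝ) ^ spongeE d b A m) :=
  theorem2_general d b m A hd (by omega) hA hN ε hε0 hε1
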